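/- Let $f(z)=\sum_{k=0}^\infty a_k z^k$ be an entire function with $a_k>0$ for all $k\ge 0$, and put $q_n=\dfrac{a_{n-1}^2}{a_{n-2}a_n}$ for $n\ge 2$. Suppose that $$2\sqrt[3]{2}\le q_2\le q_3\le q_4\le\cdots .$$ For $n\ge 2$ let $c_n$ be the infimum of the numbers $a^2$, $a>1$, for which the polynomial $\sum_{j=0}^n a^{-j^2}z^j$ belongs to the Laguerre--Pólya class, that is, the class of functions of the form $c z^s e^{-\alpha z^2+\beta z}\prod_k(1-z/x_k)e^{z/x_k}$ with a finite (possibly empty) or infinite product, $c,\alpha,\beta,x_k\in\mathbb R$, $\alpha\ge 0$, $x_k\ne 0$, $s\in\mathbb Z_{\ge 0}$, and $\sum_k x_k^{-2}<\infty$. (It is known that, for $a>1$, this polynomial is in the class if and only if $a^2\ge c_n$.) If there are integers $j_0\ge 2$ and $m_0\ge 1$ such that $q_{j_0}\ge c_{2m_0}$, then the number of nonreal zeros of $f$, counted with multiplicity, does not exceed $j_0+2m_0-2$. -/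

import Mathlib

/-- The Laguerre–Pólya class: functions of the form
`c zⁿ exp(-α z² + β z) ∏ₖ (1 - z / xₖ) exp(z / xₖ)` with `c, α, β, xₖ` real, `α ≥ 0`, `xₖ ≠ 0`
and `∑ₖ xₖ⁻² < ∞`. The index set `I` is an arbitrary subset of `ℕ`, so that the product may be
infinite, finite or empty. -/
def LaguerrePolya (f : ℂ → ℂ) : Prop :=
  ∃ (c α β : ℝ) (n : ℕ) (I : Set ℕ) (x : I → ℝ) (P : ℂ → ℂ),
    0 ≤ α ∧ (∀ k, x k ≠ 0) ∧ Summable (fun k => ((x k) ^ 2)⁻¹) ∧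
    (∀ z : ℂ, HasProd (fun k => (1 - z / (x k : ℂ)) * Complex.exp (z / (x k : ℂ))) (P z)) ∧
    ∀ z : ℂ, f z = (c : ℂ) * z ^ n * Complex.exp (-(α : ℂ) * z ^ 2 + (β : ℂ) * z) * P z

/-- The section `S_n(z, g_a) = ∑_{j=0}^n a^{-j²} z^j` of the partial theta function `g_a`. -/
noncomputable def partialThetaSection (a : ℝ) (n : ℕ) (z : ℂ) : ℂ :=
  ∑ j ∈ Finset.range (n + 1), ((a : ℂ) ^ (j ^ 2))⁻¹ * z ^ j

/-- The threshold constant `c_n` (`n ≥ 2`): the infimum of the values `a²`, `a > 1`, for which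
`S_n(·, g_a)` is in the Laguerre–Pólya class. -/
noncomputable def thetaConst (n : ℕ) : ℝ :=
  sInf {t : ℝ | ∃ a : ℝ, 1 < a ∧ t = a ^ 2 ∧ LaguerrePolya (partialThetaSection a n)}

/-- The second quotient `q_n = a_{n-1}² / (a_{n-2} a_n)` of the coefficients, for `n ≥ 2`. -/
noncomputable def secondQuotient (a : ℕ → ℝ) (n : ℕ) : ℝ :=
  a (n - 1) ^ 2 / (a (n - 2) * a n)

/-- The set of nonreal zeros of `f`. -/
def nonrealZeros (f : ℂ → ℂ) : Set ℂ := {z : ℂ | f z = 0 ∧ z.im ≠ 0}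

/-!
Write `p_k = a_k / a_{k+1}`. The threshold `c = c_{2m₀}` is at least `3`, by a Cauchy-Schwarz
inequality between the power sums of the reciprocal zeros, and the section of the partial theta
function with parameter `c` has a zero in the window corresponding to `[p_k / c, p_k]`. At the
matching point `-y` of `f`, with `p_k / c ≤ y ≤ p_k`, the `2m₀ + 1` consecutive terms of `f` up to
the one of index `k + 1` are those of the section multiplied by damping weights which only help,
and the remaining terms form alternating sums with monotone terms. This fixes the sign of `f (-y)`,
and the signs alternate with `k`, so `f` has real zeros `ξ_i` with `|ξ_i| ≤ p_{N+i}` for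
`N = j₀ + 2m₀ - 2`.

On the circle `|z| = p_K` the maximal term dominates, `|f| ≤ 4 a_0 ∏_{j<K} p_K / p_j`, so by
Jensen's formula the zeros of `f` are at least as sparse as the sequence `p`. The zeros `ξ_i` use up
all but `N` of these places, and comparing the coefficients of `log p_K` as `K → ∞` bounds the total
multiplicity of every set of further zeros by `N`.
-/

section AlternatingSums

theorem alternating_sum_nonneg {R : Type*} [CommRing R] [LinearOrder R] [IsStrictOrderedRing R]
    {N : ℕ} {D : ℕ → R} (hnonneg : ∀ i < N, 0 ≤ D i) (hanti : ∀ i, i + 1 < N → D (i + 1) ≤ D i) :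
    0 ≤ ∑ i ∈ Finset.range N, (-1) ^ i * D i := by
  induction N using Nat.twoStepInduction generalizing D with
  | zero => simp
  | one => simpa using hnonneg 0 one_pos
  | more N ih _ =>
    have htail := ih (D := fun i => D (i + 2)) (fun i hi => hnonneg _ (by lia))
      (fun i hi => hanti _ (by lia))
    have hsplit : ∑ i ∈ Finset.range (N + 2), (-1) ^ i * D i =
        ∑ i ∈ Finset.range N, (-1) ^ i * D (i + 2) + (D 0 - D 1) := by
      rw [Finset.sum_range_succ', Finset.sum_range_succ', add_assoc]
      simp only [pow_add, pow_zero, zero_add]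
      ring_nf
    linarith [hanti 0 (by lia)]

theorem alternating_sum_sign {R : Type*} [CommRing R] [LinearOrder R] [IsStrictOrderedRing R]
    {s : ℕ} {T : ℕ → R} (hnonneg : ∀ j < s, 0 ≤ T j) (hmono : ∀ j, j + 1 < s → T j ≤ T (j + 1)) :
    0 ≤ (-1) ^ (s + 1) * ∑ j ∈ Finset.range s, (-1) ^ j * T j := by
  induction s using Nat.twoStepInduction with
  | zero => simp
  | one => simpa using hnonneg 0 one_pos
  | more s ih _ =>
    have hhead := ih (fun j hj => hnonneg j (by lia)) (fun j hj => hmono j (by lia))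
    have hsign : ((-1 : R) ^ s) * (-1) ^ s = 1 := by rw [← mul_pow]; simp
    have hsplit : (-1) ^ (s + 2 + 1) * ∑ j ∈ Finset.range (s + 2), (-1) ^ j * T j =
        (-1) ^ (s + 1) * ∑ j ∈ Finset.range s, (-1) ^ j * T j + (T (s + 1) - T s) := by
      rw [Finset.sum_range_succ, Finset.sum_range_succ]
      linear_combination (T (s + 1) - T s) * hsign
    linarith [hmono s (by lia)]

theorem sub_le_of_hasSum_alternating {f : ℕ → ℝ} {l : ℝ}
    (hf : HasSum (fun i => (-1) ^ i * f i) l) (hanti : Antitone f) : f 0 - f 1 ≤ l := by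
  simpa [Finset.sum_range_succ, sub_eq_add_neg] using
    hanti.alternating_series_le_tendsto hf.tendsto_sum_nat 1

theorem alternating_block_le {T : ℕ → ℝ} {S : ℝ} (hS : HasSum (fun j => (-1) ^ j * T j) S)
    {s m : ℕ} (hnonneg : ∀ j < s, 0 ≤ T j) (hmono : ∀ j, j + 1 < s → T j ≤ T (j + 1))
    (hanti : AntitoneOn T (Set.Ici (s + 2 * m + 1))) :
    T (s + 2 * m + 1) - T (s + 2 * m + 2) - ∑ i ∈ Finset.range (2 * m + 1), (-1) ^ i * T (s + i) ≤
      (-1) ^ (s + 1) * S := by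
  have hsign : ((-1 : ℝ) ^ s) * (-1) ^ s = 1 := by rw [← mul_pow]; simp
  have htail : HasSum (fun i => (-1) ^ i * T (s + (2 * m + 1) + i)) ((-1) ^ (s + 1) *
      (S - ∑ j ∈ Finset.range (s + (2 * m + 1)), (-1) ^ j * T j)) := by
    refine (((hasSum_nat_add_iff' (s + (2 * m + 1))).2 hS).mul_left _).congr_fun fun i => ?_
    rw [add_comm i, pow_add _ _ i, pow_add _ s (2 * m + 1), pow_add _ s 1,
      (odd_two_mul_add_one m).neg_one_pow]
    linear_combination -(-1) ^ i * T (s + (2 * m + 1) + i) * hsign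
  have htail_le := sub_le_of_hasSum_alternating htail fun i j hij =>
    hanti (Set.mem_Ici.2 (by lia)) (Set.mem_Ici.2 (by lia)) (by lia)
  have hblock : (-1) ^ (s + 1) * ∑ i ∈ Finset.range (2 * m + 1), (-1) ^ (s + i) * T (s + i) =
      -∑ i ∈ Finset.range (2 * m + 1), (-1) ^ i * T (s + i) := by
    rw [Finset.mul_sum, ← Finset.sum_neg_distrib]
    refine Finset.sum_congr rfl fun i _ => ?_
    linear_combination -(-1) ^ i * T (s + i) * hsign
  have hhead := alternating_sum_sign hnonneg hmono
  rw [Finset.sum_range_add, mul_sub, mul_add, hblock] at htail_le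
  simp only [add_zero, ← add_assoc] at htail_le
  linarith

theorem alternating_sum_sign_of_peak {T : ℕ → ℝ} {S : ℝ} (hS : HasSum (fun j => (-1) ^ j * T j) S)
    {k : ℕ} (hnonneg : ∀ j, 0 ≤ T j) (hmono : ∀ j < k, T j ≤ T (j + 1))
    (hanti : AntitoneOn T (Set.Ici k)) (hright : 2 * T (k + 1) < T k)
    (hleft : ∀ i, i + 1 = k → 2 * T i < T k) : 0 < (-1) ^ k * S := by
  cases k with
  | zero =>
    have hle := sub_le_of_hasSum_alternating hS fun i j hij => hanti i.zero_le j.zero_le hij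
    rw [pow_zero, one_mul]
    linarith [hnonneg 1]
  | succ k =>
    have hle := alternating_block_le hS (s := k) (m := 1) (fun j _ => hnonneg j)
      (fun j hj => hmono j (by lia)) (hanti.mono (Set.Ici_subset_Ici.2 (by lia)))
    have hdecr : T (k + 4) ≤ T (k + 3) :=
      hanti (Set.mem_Ici.2 (by lia)) (Set.mem_Ici.2 (by lia)) (by lia)
    simp only [Finset.sum_range_succ, Finset.sum_range_zero, mul_one, add_zero, Nat.add_assoc,
      Nat.reduceAdd] at hle hright
    linarith [hleft k rfl]

theorem exists_zero_of_alternating {g : ℝ → ℝ} (hg : Continuous g) {x y : ℝ} {k : ℕ} (hyx : y ≤ x)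
    (hx : 0 < (-1) ^ k * g x) (hy : 0 < (-1) ^ (k + 1) * g y) : ∃ ξ ∈ Set.Ioo y x, g ξ = 0 := by
  have hcont : ContinuousOn (fun v => (-1) ^ k * g v) (Set.Icc y x) := by fun_prop
  have hneg : (-1) ^ k * g y < 0 := by rw [pow_succ] at hy; linarith
  obtain ⟨ξ, hξ, hzero⟩ := intermediate_value_Ioo hyx hcont ⟨hneg, hx⟩
  exact ⟨ξ, hξ, by simpa using hzero⟩

end AlternatingSums

section Polynomials

open Polynomial

theorem splits_of_natDegree_le_card {R : Type*} [CommRing R] [IsDomain R] {p : R[X]} (hp : p ≠ 0)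
    {s : Finset R} (hs : ∀ x ∈ s, p.IsRoot x) (hcard : p.natDegree ≤ s.card) : p.Splits :=
  splits_iff_card_roots.2 <| le_antisymm p.card_roots' <| hcard.trans <|
    Multiset.card_le_card <| Finset.val_le_iff_val_subset.2 fun x hx => (mem_roots hp).2 (hs x hx)

theorem exists_eq_prod_one_add_of_splits {K : Type*} [Field K] {p : K[X]} (hp : p.Splits)
    (h0 : p.coeff 0 ≠ 0) : ∃ (n : ℕ) (y : Fin n → K),
      (∀ i, y i ≠ 0) ∧ p = C (p.coeff 0) * ∏ i, (1 + C (y i) * X) := by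
  obtain ⟨l, hl⟩ := Quotient.exists_rep p.roots
  have hroot_ne (i : Fin l.length) : l.get i ≠ 0 := by
    intro hi
    have hmem : l.get i ∈ p.roots := hl ▸ Multiset.mem_coe.2 (l.get_mem i)
    rw [hi, mem_roots', IsRoot, ← coeff_zero_eq_eval_zero] at hmem
    exact h0 hmem.2
  have hlinear (i : Fin l.length) :
      X - C (l.get i) = C (-l.get i) * (1 + C (-(l.get i)⁻¹) * X) := by
    rw [mul_add, ← mul_assoc, ← C_mul, neg_mul_neg, mul_inv_cancel₀ (hroot_ne i)]
    simp only [map_neg, mul_one, map_one, one_mul]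
    ring
  have hfactor : p = C (p.leadingCoeff * ∏ i, -l.get i) * ∏ i, (1 + C (-(l.get i)⁻¹) * X) := by
    calc p = C p.leadingCoeff * ∏ i, (X - C (l.get i)) := by
          conv_lhs => rw [hp.eq_prod_roots, ← hl]
          simp [← Fin.prod_univ_fun_getElem]
      _ = _ := by
          simp_rw [hlinear, Finset.prod_mul_distrib, ← map_prod, ← mul_assoc, ← C_mul]
  have hcoeff : p.coeff 0 = p.leadingCoeff * ∏ i, -l.get i := by
    conv_lhs => rw [hfactor]
    simp [coeff_zero_eq_eval_zero, eval_prod]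
  exact ⟨l.length, fun i => -(l.get i)⁻¹, fun i => neg_ne_zero.2 (inv_ne_zero (hroot_ne i)),
    by rwa [hcoeff]⟩

variable {ι R : Type*} [CommRing R] (s : Finset ι) (y : ι → R)

theorem coeff_succ_one_add_C_mul_X_mul (r : R) (p : R[X]) (n : ℕ) :
    ((1 + C r * X) * p).coeff (n + 1) = p.coeff (n + 1) + r * p.coeff n := by
  rw [add_mul, one_mul, coeff_add, mul_assoc, coeff_C_mul, coeff_X_mul]

theorem coeff_zero_prod_one_add : (∏ i ∈ s, (1 + C (y i) * X)).coeff 0 = 1 := by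
  simp [coeff_zero_eq_eval_zero, eval_prod]

theorem sum_eq_coeff_prod_one_add :
    ∑ i ∈ s, y i = (∏ i ∈ s, (1 + C (y i) * X)).coeff 1 := by
  classical
  induction s using Finset.induction_on with
  | empty => simp [coeff_one]
  | insert i s hi ih =>
    rw [Finset.sum_insert hi, Finset.prod_insert hi, coeff_succ_one_add_C_mul_X_mul,
      coeff_zero_prod_one_add, ih]
    ring

theorem sum_sq_eq_coeff_prod_one_add :
    ∑ i ∈ s, y i ^ 2 = (∏ i ∈ s, (1 + C (y i) * X)).coeff 1 ^ 2 -
      2 * (∏ i ∈ s, (1 + C (y i) * X)).coeff 2 := by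
  classical
  induction s using Finset.induction_on with
  | empty => simp [coeff_one]
  | insert i s hi ih =>
    simp only [Finset.sum_insert hi, Finset.prod_insert hi, coeff_succ_one_add_C_mul_X_mul,
      coeff_zero_prod_one_add, ih]
    ring

theorem sum_cube_eq_coeff_prod_one_add :
    ∑ i ∈ s, y i ^ 3 = (∏ i ∈ s, (1 + C (y i) * X)).coeff 1 ^ 3 -
      3 * (∏ i ∈ s, (1 + C (y i) * X)).coeff 1 * (∏ i ∈ s, (1 + C (y i) * X)).coeff 2 +
      3 * (∏ i ∈ s, (1 + C (y i) * X)).coeff 3 := by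
  classical
  induction s using Finset.induction_on with
  | empty => simp [coeff_one]
  | insert i s hi ih =>
    simp only [Finset.sum_insert hi, Finset.prod_insert hi, coeff_succ_one_add_C_mul_X_mul,
      coeff_zero_prod_one_add, ih]
    ring

end Polynomials

section LaguerrePolya

open Polynomial

theorem norm_one_sub_mul_exp_sub_one_le {w : ℂ} (hw : ‖w‖ ≤ 1) :
    ‖(1 - w) * Complex.exp w - 1‖ ≤ 3 * ‖w‖ ^ 2 := by
  have hsub : ‖1 - w‖ ≤ 2 := (norm_sub_le _ _).trans (by rw [norm_one]; linarith)
  calc ‖(1 - w) * Complex.exp w - 1‖ = ‖(1 - w) * (Complex.exp w - 1 - w) - w ^ 2‖ := by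
        congr 1; ring
    _ ≤ ‖1 - w‖ * ‖Complex.exp w - 1 - w‖ + ‖w‖ ^ 2 :=
        (norm_sub_le _ _).trans_eq (by rw [norm_mul, norm_pow])
    _ ≤ 2 * ‖w‖ ^ 2 + ‖w‖ ^ 2 := by gcongr; exact Complex.norm_exp_sub_one_sub_id_le hw
    _ = 3 * ‖w‖ ^ 2 := by ring

theorem exists_eq_one_of_hasProd_eq_zero {ι : Type*} {w : ι → ℂ}
    (hw : Summable fun k => ‖w k‖ ^ 2)
    (hprod : HasProd (fun k => (1 - w k) * Complex.exp (w k)) 0) : ∃ k, w k = 1 := by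
  by_contra! hne
  have hsmall : ∀ᶠ k in Filter.cofinite, ‖w k‖ ≤ 1 := by
    filter_upwards [hw.tendsto_cofinite_zero.eventually (gt_mem_nhds one_pos)] with k hk
    exact ((sq_lt_one_iff₀ (norm_nonneg _)).1 hk).le
  have hsummable : Summable fun k => ‖(1 - w k) * Complex.exp (w k) - 1‖ := by
    refine Summable.of_norm_bounded_eventually (hw.mul_left 3) ?_
    filter_upwards [hsmall] with k hk
    simpa only [norm_norm] using norm_one_sub_mul_exp_sub_one_le hk
  refine tprod_one_add_ne_zero_of_summable (fun k => ?_) hsummable ?_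
  · rw [add_sub_cancel]
    exact mul_ne_zero (sub_ne_zero.2 (hne k).symm) (Complex.exp_ne_zero _)
  · simpa only [add_sub_cancel] using hprod.tprod_eq

theorem LaguerrePolya.im_eq_zero {f : ℂ → ℂ} (hf : LaguerrePolya f) (hne : f ≠ 0) {z : ℂ}
    (hz : f z = 0) : z.im = 0 := by
  obtain ⟨c, α, β, n, I, x, P, -, -, hsummable, hP, hfP⟩ := hf
  have hc : (c : ℂ) ≠ 0 := by
    intro hc
    exact hne (funext fun w => by simp [hfP, hc])
  simp only [hfP, mul_eq_zero, hc, Complex.exp_ne_zero, false_or, or_false] at hz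
  rcases hz with hz | hz
  · simp [eq_zero_of_pow_eq_zero hz]
  · have hnorm : Summable fun k => ‖z / (x k : ℂ)‖ ^ 2 := by
      refine (hsummable.mul_left (‖z‖ ^ 2)).congr fun k => ?_
      rw [norm_div, div_pow, Complex.norm_real, Real.norm_eq_abs, sq_abs, div_eq_mul_inv]
    obtain ⟨k, hk⟩ := exists_eq_one_of_hasProd_eq_zero hnorm (hz ▸ hP z)
    rw [eq_of_div_eq_one hk, Complex.ofReal_im]

theorem LaguerrePolya.splits {p : ℝ[X]} (hp : p ≠ 0) (h : LaguerrePolya fun z => aeval z p) :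
    p.Splits := by
  have hne : (fun z : ℂ => aeval z p) ≠ 0 := by
    intro hzero
    refine hp (map_injective _ (algebraMap ℝ ℂ).injective (funext fun z => ?_))
    simpa [eval_map_algebraMap] using congrFun hzero z
  refine Splits.of_splits_map (algebraMap ℝ ℂ) (IsAlgClosed.splits _) fun z hz => ?_
  have hroot : aeval z p = 0 := by
    simpa [eval_map_algebraMap] using (mem_roots'.1 hz).2
  exact ⟨z.re, Complex.ext rfl (h.im_eq_zero hne hroot).symm⟩

theorem laguerrePolya_prod (c : ℝ) {n : ℕ} {x : Fin n → ℝ} (hx : ∀ k, x k ≠ 0) :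
    LaguerrePolya fun z => c * ∏ k, (1 - z / (x k : ℂ)) := by
  let I : Set ℕ := {k | k < n}
  have : Fintype I := (Set.finite_lt_nat n).fintype
  let e : I ≃ Fin n := Fin.equivSubtype.symm
  -- The exponent `β` cancels the convergence factors `exp (z / xₖ)`.
  refine ⟨c, 0, -∑ k, (x k)⁻¹, 0, I, fun k => x (e k),
    fun z => ∏ k, ((1 - z / (x k : ℂ)) * Complex.exp (z / (x k : ℂ))), le_rfl, fun k => hx _,
    Summable.of_finite, fun z => ?_, fun z => ?_⟩
  · beta_reduce
    rw [← e.prod_comp]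
    exact hasProd_fintype _
  · have hexp : Complex.exp (-((0 : ℝ) : ℂ) * z ^ 2 + ((-∑ k, (x k)⁻¹ : ℝ) : ℂ) * z) *
        ∏ k, Complex.exp (z / (x k : ℂ)) = 1 := by
      rw [← Complex.exp_sum, ← Complex.exp_add, ← Complex.exp_zero]
      congr 1
      push_cast
      simp only [div_eq_mul_inv, ← Finset.mul_sum]
      ring
    beta_reduce
    rw [Finset.prod_mul_distrib]
    linear_combination -(c * ∏ k, (1 - z / (x k : ℂ))) * hexp

theorem laguerrePolya_of_splits {p : ℝ[X]} (hp : p.Splits) (h0 : p.coeff 0 ≠ 0) :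
    LaguerrePolya fun z => aeval z p := by
  obtain ⟨n, y, hy, hfactor⟩ := exists_eq_prod_one_add_of_splits hp h0
  convert laguerrePolya_prod (p.coeff 0) (x := fun i => -(y i)⁻¹)
    (fun i => neg_ne_zero.2 (inv_ne_zero (hy i))) using 2 with z
  conv_lhs => rw [hfactor]
  simp only [map_mul, map_prod, map_add, map_one, aeval_C, aeval_X]
  simp [div_neg, mul_comm]

end LaguerrePolya

section ThetaSections

open Polynomial

/-- The section `S_n(·, g_a)` of the partial theta function as a polynomial over `ℝ`. -/
noncomputable def thetaPoly (a : ℝ) (n : ℕ) : ℝ[X] :=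
  ∑ j ∈ Finset.range (n + 1), C (a ^ (j ^ 2))⁻¹ * X ^ j

/-- The section of the partial theta function with all signs alternating, rescaled so that it only
depends on `t = a²`: it equals `S_N(-u a, g_a)`, see `thetaWindow_sq`. -/
noncomputable def thetaWindow (N : ℕ) (t u : ℝ) : ℝ :=
  ∑ i ∈ Finset.range (N + 1), (-1) ^ i * (u ^ i / t ^ i.choose 2)

theorem aeval_thetaPoly (a : ℝ) (n : ℕ) (z : ℂ) :
    aeval z (thetaPoly a n) = partialThetaSection a n z := by
  simp [thetaPoly, partialThetaSection]

theorem eval_thetaPoly (a : ℝ) (n : ℕ) (x : ℝ) :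
    (thetaPoly a n).eval x = ∑ j ∈ Finset.range (n + 1), (a ^ (j ^ 2))⁻¹ * x ^ j := by
  simp [thetaPoly, eval_finsetSum]

theorem coeff_thetaPoly (a : ℝ) (n k : ℕ) :
    (thetaPoly a n).coeff k = if k < n + 1 then (a ^ (k ^ 2))⁻¹ else 0 := by
  simp [thetaPoly, coeff_C_mul, coeff_X_pow]

theorem coeff_zero_thetaPoly (a : ℝ) (n : ℕ) : (thetaPoly a n).coeff 0 = 1 := by
  simp [coeff_thetaPoly]

theorem thetaPoly_ne_zero (a : ℝ) (n : ℕ) : thetaPoly a n ≠ 0 := by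
  intro h
  simpa [h] using coeff_zero_thetaPoly a n

theorem natDegree_thetaPoly_le (a : ℝ) (n : ℕ) : (thetaPoly a n).natDegree ≤ n :=
  natDegree_le_iff_coeff_eq_zero.2 fun k hk => by simp [coeff_thetaPoly, hk.not_ge]

theorem laguerrePolya_partialThetaSection_iff {a : ℝ} {n : ℕ} :
    LaguerrePolya (partialThetaSection a n) ↔ (thetaPoly a n).Splits := by
  have heq : partialThetaSection a n = fun z => aeval z (thetaPoly a n) :=
    funext fun z => (aeval_thetaPoly a n z).symm
  rw [heq]
  exact ⟨LaguerrePolya.splits (thetaPoly_ne_zero a n),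
    fun h => laguerrePolya_of_splits h (by simp [coeff_zero_thetaPoly])⟩

theorem eval_thetaPoly_pos {a x : ℝ} (ha : 0 < a) (hx : 0 ≤ x) (n : ℕ) :
    0 < (thetaPoly a n).eval x := by
  rw [eval_thetaPoly, Finset.sum_range_succ']
  positivity

theorem thetaWindow_sq {a : ℝ} (ha : a ≠ 0) (N : ℕ) (u : ℝ) :
    thetaWindow N (a ^ 2) u = (thetaPoly a N).eval (-(u * a)) := by
  rw [eval_thetaPoly]
  refine Finset.sum_congr rfl fun i _ => ?_
  have hexp : i ^ 2 = 2 * i.choose 2 + i := by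
    rw [Nat.choose_two_right, Nat.mul_div_cancel' (Nat.even_mul_pred_self i).two_dvd, sq]
    cases i <;> simp [mul_add]
  rw [hexp, pow_add, pow_mul, neg_pow (u * a), mul_pow]
  field_simp

theorem exists_thetaPoly_eq_prod {a : ℝ} (ha : 0 < a) {n : ℕ} (h : (thetaPoly a n).Splits) :
    ∃ (N : ℕ) (y : Fin N → ℝ), (∀ i, 0 < y i) ∧ thetaPoly a n = ∏ i, (1 + C (y i) * X) := by
  obtain ⟨N, y, hy, hfactor⟩ :=
    exists_eq_prod_one_add_of_splits h (by simp [coeff_zero_thetaPoly])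
  rw [coeff_zero_thetaPoly, C_1, one_mul] at hfactor
  refine ⟨N, y, fun i => (hy i).lt_or_gt.resolve_left fun hneg => ?_, hfactor⟩
  have hpos := eval_thetaPoly_pos ha (x := -(y i)⁻¹) (by simpa using hneg.le) n
  rw [hfactor, eval_prod, Finset.prod_eq_zero (Finset.mem_univ i) (by simp [hy i])] at hpos
  exact hpos.false

theorem exists_powerSums_of_splits_thetaPoly {a : ℝ} (ha : 0 < a) {n : ℕ} (hn : 2 ≤ n)
    (h : (thetaPoly a n).Splits) :
    ∃ (N : ℕ) (y : Fin N → ℝ), (∀ i, 0 < y i ∧ (thetaPoly a n).eval (-(y i)⁻¹) = 0) ∧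
      ∑ i, y i = a⁻¹ ∧ ∑ i, y i ^ 2 = a⁻¹ ^ 2 - 2 * a⁻¹ ^ 4 ∧
      ∑ i, y i ^ 3 ≤ a⁻¹ ^ 3 - 3 * a⁻¹ ^ 5 + 3 * a⁻¹ ^ 9 := by
  obtain ⟨N, y, hy, hfactor⟩ := exists_thetaPoly_eq_prod ha h
  have hcoeff₁ : (thetaPoly a n).coeff 1 = a⁻¹ := by
    rw [coeff_thetaPoly, if_pos (by lia), one_pow, pow_one]
  have hcoeff₂ : (thetaPoly a n).coeff 2 = a⁻¹ ^ 4 := by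
    rw [coeff_thetaPoly, if_pos (by lia), inv_pow]; norm_num
  have hcoeff₃ : (thetaPoly a n).coeff 3 ≤ a⁻¹ ^ 9 := by
    rw [coeff_thetaPoly, inv_pow]
    split_ifs
    exacts [le_rfl, by positivity]
  have hroot (i : Fin N) : (thetaPoly a n).eval (-(y i)⁻¹) = 0 := by
    rw [hfactor, eval_prod]
    exact Finset.prod_eq_zero (Finset.mem_univ i) (by simp [(hy i).ne'])
  refine ⟨N, y, fun i => ⟨hy i, hroot i⟩, ?_, ?_, ?_⟩
  · rw [sum_eq_coeff_prod_one_add, ← hfactor, hcoeff₁]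
  · rw [sum_sq_eq_coeff_prod_one_add, ← hfactor, hcoeff₁, hcoeff₂]
  · rw [sum_cube_eq_coeff_prod_one_add, ← hfactor, hcoeff₁, hcoeff₂]
    linarith

theorem three_le_sq_of_splits_thetaPoly {a : ℝ} (ha : 1 < a) {n : ℕ} (hn : 2 ≤ n)
    (h : (thetaPoly a n).Splits) : 3 ≤ a ^ 2 := by
  obtain ⟨N, y, hy, hsum₁, hsum₂, hsum₃⟩ :=
    exists_powerSums_of_splits_thetaPoly (by positivity) hn h
  set b := a⁻¹
  have hb : 0 < b := by positivity
  have hb1 : b < 1 := inv_lt_one_of_one_lt₀ ha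
  have hcauchy : (∑ i, y i ^ 2) ^ 2 ≤ (∑ i, y i) * ∑ i, y i ^ 3 :=
    Finset.sum_sq_le_sum_mul_sum_of_sq_le_mul _ (fun i _ => (hy i).1.le)
      (fun i _ => (pow_pos (hy i).1 3).le) fun i _ => by ring_nf; rfl
  rw [hsum₁, hsum₂] at hcauchy
  have hquad : 0 ≤ b ^ 6 * ((1 - b ^ 2) * (1 - 3 * b ^ 2)) := by
    linarith [mul_le_mul_of_nonneg_left hsum₃ hb.le]
  have hb3 : 0 ≤ 1 - 3 * b ^ 2 :=
    nonneg_of_mul_nonneg_right (nonneg_of_mul_nonneg_right hquad (by positivity)) (by nlinarith)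
  have hab : a ^ 2 * b ^ 2 = 1 := by rw [← mul_pow, mul_inv_cancel₀ (by positivity), one_pow]
  nlinarith [sq_nonneg a]

theorem exists_eval_thetaPoly_neg_eq_zero {a : ℝ} (ha : 1 < a) {n : ℕ} (hn : 2 ≤ n)
    (h : (thetaPoly a n).Splits) : ∃ x ∈ Set.Icc a (a ^ 3), (thetaPoly a n).eval (-x) = 0 := by
  obtain ⟨N, y, hy, hsum₁, hsum₂, -⟩ :=
    exists_powerSums_of_splits_thetaPoly (by positivity) hn h
  have ha0 : 0 < a := by positivity
  have hb3 : 3 * a⁻¹ ^ 2 ≤ 1 := by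
    rw [inv_pow, ← div_eq_mul_inv, div_le_one (by positivity)]
    exact three_le_sq_of_splits_thetaPoly ha hn h
  have hne : (Finset.univ : Finset (Fin N)).Nonempty :=
    Finset.nonempty_of_sum_ne_zero (hsum₁ ▸ (inv_pos.2 ha0).ne')
  have hle : ∑ i, a⁻¹ ^ 3 * y i ≤ ∑ i, y i ^ 2 := by
    rw [← Finset.mul_sum, hsum₁, hsum₂]
    linarith [mul_le_mul_of_nonneg_left hb3 (sq_nonneg a⁻¹)]
  obtain ⟨i, -, hi⟩ := Finset.exists_le_of_sum_le hne hle
  have hlower : a⁻¹ ^ 3 ≤ y i := le_of_mul_le_mul_right (hi.trans_eq (sq (y i))) (hy i).1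
  have hupper : y i ≤ a⁻¹ :=
    hsum₁ ▸ Finset.single_le_sum (fun j _ => (hy j).1.le) (Finset.mem_univ i)
  refine ⟨(y i)⁻¹, ⟨?_, ?_⟩, (hy i).2⟩
  · exact (le_inv_comm₀ ha0 (hy i).1).2 hupper
  · exact (inv_le_comm₀ (hy i).1 (by positivity)).2 (by rwa [← inv_pow])

theorem hasSum_eval_thetaPoly {a : ℝ} (ha : a ≠ 0) (n k : ℕ) :
    HasSum (fun j => (-1) ^ j * if j ≤ n then a ^ ((k : ℤ) ^ 2 - ((j : ℤ) - k) ^ 2) else 0)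
      ((thetaPoly a n).eval (-a ^ (2 * k))) := by
  rw [eval_thetaPoly]
  convert hasSum_sum_of_ne_finset_zero (s := Finset.range (n + 1)) (L := .unconditional ℕ)
    fun j hj => ?_ using 1
  · refine Finset.sum_congr rfl fun j hj => ?_
    rw [if_pos (Nat.lt_succ_iff.1 (Finset.mem_range.1 hj)),
      show (k : ℤ) ^ 2 - ((j : ℤ) - k) ^ 2 = (2 * k * j : ℕ) - (j ^ 2 : ℕ) by push_cast; ring,
      zpow_sub₀ ha, zpow_natCast, zpow_natCast, neg_pow, ← pow_mul]
    ring
  · rw [if_neg (by simpa using hj), mul_zero]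

theorem eval_thetaPoly_sign {a : ℝ} (ha : 2 < a) {n k : ℕ} (hk : k ≤ n) :
    0 < (-1) ^ k * (thetaPoly a n).eval (-a ^ (2 * k)) := by
  have hS := hasSum_eval_thetaPoly (show a ≠ 0 by positivity) n k
  set T : ℕ → ℝ := fun j => if j ≤ n then a ^ ((k : ℤ) ^ 2 - ((j : ℤ) - k) ^ 2) else 0
  have hnonneg (j : ℕ) : 0 ≤ T j := by
    unfold T; split_ifs <;> positivity
  have hT (j : ℕ) : T j ≤ a ^ ((k : ℤ) ^ 2 - ((j : ℤ) - k) ^ 2) := by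
    unfold T; split_ifs; exacts [le_rfl, by positivity]
  have hmono (j : ℕ) (hj : j < k) : T j ≤ T (j + 1) := by
    rw [show T (j + 1) = _ from if_pos (by lia)]
    refine (hT j).trans (zpow_le_zpow_right₀ (by linarith) ?_)
    push_cast
    nlinarith
  have hanti : AntitoneOn T (Set.Ici k) := by
    refine antitoneOn_nat_Ici_of_succ_le fun j hj => ?_
    by_cases hjn : j + 1 ≤ n
    · rw [show T j = _ from if_pos (by lia)]
      refine (hT (j + 1)).trans (zpow_le_zpow_right₀ (by linarith) ?_)
      push_cast
      nlinarith
    · rw [show T (j + 1) = 0 from if_neg hjn]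
      exact hnonneg j
  have hpeak : 0 < T k := by
    rw [show T k = _ from if_pos hk]; positivity
  have hneighbour (j : ℕ) (hj : ((j : ℤ) - k) ^ 2 = 1) : 2 * T j < T k := by
    have hTk : T k = a * a ^ ((k : ℤ) ^ 2 - ((j : ℤ) - k) ^ 2) := by
      rw [show T k = _ from if_pos hk, hj, ← zpow_one_add₀ (by positivity)]
      ring_nf
    nlinarith [hT j, hnonneg j]
  exact alternating_sum_sign_of_peak hS hnonneg hmono hanti
    (hneighbour _ (by simp)) fun i hi => hneighbour i (by simp [← hi])

theorem splits_thetaPoly {a : ℝ} (ha : 2 < a) (n : ℕ) : (thetaPoly a n).Splits := by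
  have hzero (k : Fin n) : ∃ ξ ∈ Set.Ioo (-a ^ (2 * (k + 1 : ℕ))) (-a ^ (2 * (k : ℕ))),
      (thetaPoly a n).eval ξ = 0 :=
    exists_zero_of_alternating (thetaPoly a n).continuous
      (neg_le_neg (pow_le_pow_right₀ (by linarith) (by lia)))
      (eval_thetaPoly_sign ha k.2.le) (eval_thetaPoly_sign ha k.2)
  choose ξ hξ hroot using hzero
  have hanti : StrictAnti ξ := fun k l hkl =>
    (hξ l).2.trans_le <| (neg_le_neg (pow_le_pow_right₀ (by linarith) (by lia))).trans (hξ k).1.le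
  refine splits_of_natDegree_le_card (thetaPoly_ne_zero a n) (s := Finset.univ.image ξ)
    (by simpa using hroot) ?_
  rw [Finset.card_image_of_injective _ hanti.injective, Finset.card_fin]
  exact natDegree_thetaPoly_le a n

end ThetaSections

section ThetaConst

theorem isClosed_setOf_exists_thetaWindow_eq_zero (n : ℕ) :
    IsClosed {t : ℝ | 3 ≤ t ∧ ∃ u ∈ Set.Icc 1 t, thetaWindow n t u = 0} := by
  refine IsSeqClosed.isClosed fun t l ht hl => ?_
  choose hle u hu hzero using ht
  obtain ⟨B, hB⟩ := hl.bddAbove_range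
  have hmem (i : ℕ) : u i ∈ Set.Icc 1 B := ⟨(hu i).1, (hu i).2.trans (hB ⟨i, rfl⟩)⟩
  obtain ⟨v, -, φ, hφ, hv⟩ := isCompact_Icc.tendsto_subseq hmem
  have hlφ := hl.comp hφ.tendsto_atTop
  have hl3 : 3 ≤ l := ge_of_tendsto' hl hle
  refine ⟨hl3, v, ⟨ge_of_tendsto' hv fun i => (hu _).1,
    le_of_tendsto_of_tendsto' hv hlφ fun i => (hu _).2⟩, ?_⟩
  have hwindow : Filter.Tendsto (fun i => thetaWindow n (t (φ i)) (u (φ i))) Filter.atTop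
      (nhds (thetaWindow n l v)) :=
    tendsto_finsetSum _ fun i _ =>
      ((hv.pow i).div (hlφ.pow _) (pow_pos (by linarith) _).ne').const_mul _
  exact tendsto_nhds_unique hwindow (by simp [hzero])

theorem exists_thetaWindow_eq_zero_of_laguerrePolya {a : ℝ} (ha : 1 < a) {n : ℕ} (hn : 2 ≤ n)
    (h : LaguerrePolya (partialThetaSection a n)) :
    3 ≤ a ^ 2 ∧ ∃ u ∈ Set.Icc 1 (a ^ 2), thetaWindow n (a ^ 2) u = 0 := by
  have hsplits := laguerrePolya_partialThetaSection_iff.1 h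
  have ha0 : 0 < a := by positivity
  obtain ⟨x, ⟨hax, hxa⟩, hzero⟩ := exists_eval_thetaPoly_neg_eq_zero ha hn hsplits
  refine ⟨three_le_sq_of_splits_thetaPoly ha hn hsplits, x / a, ⟨?_, ?_⟩, ?_⟩
  · exact (one_le_div ha0).2 hax
  · rw [div_le_iff₀ ha0]
    linarith
  · rwa [thetaWindow_sq ha0.ne', div_mul_cancel₀ x ha0.ne']

theorem three_le_thetaConst_and_exists_thetaWindow_eq_zero {n : ℕ} (hn : 2 ≤ n) :
    3 ≤ thetaConst n ∧ ∃ u ∈ Set.Icc 1 (thetaConst n), thetaWindow n (thetaConst n) u = 0 := by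
  have hsubset : {t : ℝ | ∃ a : ℝ, 1 < a ∧ t = a ^ 2 ∧ LaguerrePolya (partialThetaSection a n)} ⊆
      {t : ℝ | 3 ≤ t ∧ ∃ u ∈ Set.Icc 1 t, thetaWindow n t u = 0} := by
    rintro _ ⟨a, ha, rfl, h⟩
    exact exists_thetaWindow_eq_zero_of_laguerrePolya ha hn h
  refine closure_minimal hsubset (isClosed_setOf_exists_thetaWindow_eq_zero n)
    (csInf_mem_closure ⟨3 ^ 2, 3, by norm_num, rfl, ?_⟩ ⟨3, fun t ht => (hsubset ht).1⟩)
  exact laguerrePolya_partialThetaSection_iff.2 (splits_thetaPoly (by norm_num) n)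

end ThetaConst

section DampedWindow

/-- The product of `r k` over all pairs `k < j < i`. With `r k` the quotient of `t` by a second
quotient, it measures how much smaller a coefficient is than that of the partial theta function
with constant second quotients `t`. -/
def dampingWeight (r : ℕ → ℝ) (i : ℕ) : ℝ := ∏ j ∈ Finset.range i, ∏ k ∈ Finset.range j, r k

theorem dampingWeight_succ (r : ℕ → ℝ) (i : ℕ) :
    dampingWeight r (i + 1) = dampingWeight r i * ∏ k ∈ Finset.range i, r k :=
  Finset.prod_range_succ _ _

theorem dampingWeight_zero (r : ℕ → ℝ) : dampingWeight r 0 = 1 := rfl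

theorem dampingWeight_one (r : ℕ → ℝ) : dampingWeight r 1 = 1 := by
  simp [dampingWeight_succ, dampingWeight_zero]

variable {r : ℕ → ℝ} (hr0 : ∀ k, 0 ≤ r k) (hr1 : ∀ k, r k ≤ 1)
include hr0

theorem dampingWeight_nonneg (i : ℕ) : 0 ≤ dampingWeight r i :=
  Finset.prod_nonneg fun _ _ => Finset.prod_nonneg fun k _ => hr0 k

include hr1

theorem dampingWeight_le_one (i : ℕ) : dampingWeight r i ≤ 1 :=
  Finset.prod_le_one (fun _ _ => Finset.prod_nonneg fun k _ => hr0 k)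
    fun _ _ => Finset.prod_le_one (fun k _ => hr0 k) fun k _ => hr1 k

theorem dampingWeight_cube_le (hr : Monotone r) {i : ℕ} (hi : 2 ≤ i) :
    dampingWeight r i ^ 3 ≤ dampingWeight r (i + 1) := by
  obtain ⟨i, rfl⟩ := Nat.exists_eq_add_of_le' hi
  set w := dampingWeight r
  set X : ℕ → ℝ := fun j => ∏ k ∈ Finset.range j, r k
  have hX0 (j : ℕ) : 0 ≤ X j := Finset.prod_nonneg fun k _ => hr0 k
  have hX1 (j : ℕ) : X j ≤ 1 := Finset.prod_le_one (fun k _ => hr0 k) fun k _ => hr1 k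
  have hXsucc (j : ℕ) : X (j + 1) = X j * r j := Finset.prod_range_succ _ _
  have hwsucc (j : ℕ) : w (j + 1) = w j * X j := dampingWeight_succ r j
  have hw0 := dampingWeight_nonneg hr0
  have hwX : w (i + 2) ≤ X (i + 1) := by
    rw [hwsucc]
    exact mul_le_of_le_one_left (hX0 _) (dampingWeight_le_one hr0 hr1 _)
  have hXr : X (i + 1) ≤ r (i + 1) := by
    rw [hXsucc]
    exact (mul_le_of_le_one_left (hr0 i) (hX1 i)).trans (hr i.le_succ)
  calc w (i + 2) ^ 3 = w (i + 2) * (w (i + 2) * w (i + 2)) := by ring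
    _ ≤ w (i + 2) * (X (i + 1) * r (i + 1)) := by
        gcongr
        exacts [hw0 _, hw0 _, hX0 _, hwX.trans hXr]
    _ = w (i + 2 + 1) := by rw [hwsucc (i + 2), hXsucc (i + 1)]

end DampedWindow

theorem sum_mul_le_thetaWindow {t u : ℝ} (ht : 3 ≤ t) (hu0 : 0 ≤ u) (hut : u ≤ t) {L : ℕ → ℝ}
    (hL0 : L 0 = 1) (hL1 : L 1 = 1) (hLnonneg : ∀ i, 0 ≤ L i) (hLle : ∀ i, L i ≤ 1)
    (hLcube : ∀ i, 2 ≤ i → L i ^ 3 ≤ L (i + 1)) (N : ℕ) :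
    ∑ i ∈ Finset.range (N + 2), (-1) ^ i * (u ^ i / t ^ i.choose 2 * L i) ≤
      thetaWindow (N + 1) t u := by
  set τ : ℕ → ℝ := fun i => u ^ i / t ^ i.choose 2
  have hτ (i : ℕ) : 0 ≤ τ i := by positivity
  have hτsucc (i : ℕ) (hi : 2 ≤ i) : 3 * τ (i + 1) ≤ τ i := by
    have hratio : τ (i + 1) = τ i * (u / t ^ i) := by
      simp only [τ, Nat.choose_succ_succ' i 1, Nat.choose_one_right, pow_succ, pow_add]
      field_simp
    have hle : 3 * (u / t ^ i) ≤ 1 := by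
      rw [← mul_div_assoc, div_le_one (by positivity)]
      calc 3 * u ≤ t * t := by gcongr
        _ = t ^ 2 := (sq t).symm
        _ ≤ t ^ i := pow_le_pow_right₀ (by linarith) hi
    rw [hratio]
    nlinarith [hτ i]
  have hdefect : 0 ≤ ∑ i ∈ Finset.range N, (-1) ^ i * (τ (i + 2) * (1 - L (i + 2))) := by
    refine alternating_sum_nonneg (fun i _ => mul_nonneg (hτ _) (sub_nonneg.2 (hLle _)))
      fun i _ => ?_
    have hcube : 1 - L (i + 2 + 1) ≤ 3 * (1 - L (i + 2)) := by
      nlinarith [hLcube (i + 2) (by lia), hLle (i + 2), hLnonneg (i + 2),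
        mul_nonneg (hLnonneg (i + 2)) (sub_nonneg.2 (hLle (i + 2)))]
    calc τ (i + 2 + 1) * (1 - L (i + 2 + 1)) ≤ τ (i + 2 + 1) * (3 * (1 - L (i + 2))) :=
          mul_le_mul_of_nonneg_left hcube (hτ _)
      _ = 3 * τ (i + 2 + 1) * (1 - L (i + 2)) := by ring
      _ ≤ τ (i + 2) * (1 - L (i + 2)) :=
          mul_le_mul_of_nonneg_right (hτsucc _ (by lia)) (sub_nonneg.2 (hLle _))
  have hsplit : ∑ i ∈ Finset.range N, (-1) ^ i * (τ (i + 2) * (1 - L (i + 2))) =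
      thetaWindow (N + 1) t u - ∑ i ∈ Finset.range (N + 2), (-1) ^ i * (τ i * L i) := by
    rw [show thetaWindow (N + 1) t u = ∑ i ∈ Finset.range (N + 2), (-1) ^ i * τ i from rfl,
      ← Finset.sum_sub_distrib]
    simp_rw [← mul_sub, ← mul_one_sub]
    rw [Finset.sum_range_succ', Finset.sum_range_succ']
    simp [hL0, hL1, τ, pow_succ]
  linarith

/-- The ratio `p_k = a_k / a_{k+1}`: at `|z| = p_k` the terms of index `k` and `k + 1` of
`∑ a_k z^k` have the same size. -/
noncomputable def coeffRatio (a : ℕ → ℝ) (k : ℕ) : ℝ := a k / a (k + 1)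

section CoeffRatio

variable {a : ℕ → ℝ} (ha : ∀ k, 0 < a k)
include ha

theorem secondQuotient_pos (n : ℕ) : 0 < secondQuotient a n :=
  div_pos (pow_pos (ha _) 2) (mul_pos (ha _) (ha _))

theorem coeffRatio_pos (k : ℕ) : 0 < coeffRatio a k := div_pos (ha _) (ha _)

theorem coeffRatio_mul_succ (k : ℕ) : coeffRatio a k * a (k + 1) = a k :=
  div_mul_cancel₀ _ (ha _).ne'

theorem coeffRatio_succ (k : ℕ) :
    coeffRatio a (k + 1) = secondQuotient a (k + 2) * coeffRatio a k := by
  have h0 := ha k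
  have h1 := ha (k + 1)
  have h2 := ha (k + 2)
  simp only [coeffRatio, secondQuotient, Nat.add_sub_cancel, show k + 2 - 1 = k + 1 from rfl]
  field_simp

theorem monotone_coeffRatio (hq : ∀ n, 2 ≤ n → 1 ≤ secondQuotient a n) :
    Monotone (coeffRatio a) :=
  monotone_nat_of_le_succ fun k => by
    rw [coeffRatio_succ ha]
    exact le_mul_of_one_le_left (coeffRatio_pos ha k).le (hq _ (by lia))

theorem term_succ_mul_coeffRatio (y : ℝ) (k : ℕ) :
    a (k + 1) * y ^ (k + 1) * coeffRatio a k = a k * y ^ k * y := by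
  rw [← coeffRatio_mul_succ ha k]
  ring

theorem term_le_succ {y : ℝ} (hy : 0 ≤ y) {k : ℕ} (h : coeffRatio a k ≤ y) :
    a k * y ^ k ≤ a (k + 1) * y ^ (k + 1) := by
  calc a k * y ^ k = coeffRatio a k * (a (k + 1) * y ^ k) := by
        rw [← mul_assoc, coeffRatio_mul_succ ha]
    _ ≤ y * (a (k + 1) * y ^ k) :=
        mul_le_mul_of_nonneg_right h (mul_nonneg (ha _).le (pow_nonneg hy _))
    _ = a (k + 1) * y ^ (k + 1) := by ring

theorem term_succ_le {y : ℝ} (hy : 0 ≤ y) {k : ℕ} (h : y ≤ coeffRatio a k) :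
    a (k + 1) * y ^ (k + 1) ≤ a k * y ^ k := by
  calc a (k + 1) * y ^ (k + 1) = y * (a (k + 1) * y ^ k) := by ring
    _ ≤ coeffRatio a k * (a (k + 1) * y ^ k) :=
        mul_le_mul_of_nonneg_right h (mul_nonneg (ha _).le (pow_nonneg hy _))
    _ = a k * y ^ k := by rw [← mul_assoc, coeffRatio_mul_succ ha]

theorem term_succ_lt {y : ℝ} (hy : 0 < y) {k : ℕ} (h : y < coeffRatio a k) :
    a (k + 1) * y ^ (k + 1) < a k * y ^ k := by
  calc a (k + 1) * y ^ (k + 1) = y * (a (k + 1) * y ^ k) := by ring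
    _ < coeffRatio a k * (a (k + 1) * y ^ k) :=
        mul_lt_mul_of_pos_right h (mul_pos (ha _) (pow_pos hy _))
    _ = a k * y ^ k := by rw [← mul_assoc, coeffRatio_mul_succ ha]

theorem coeffRatio_sub_mul_pow (t : ℝ) (s d : ℕ) {i : ℕ} (hi : i ≤ d + 1) :
    coeffRatio a (s + d + 1 - i) * t ^ i = coeffRatio a (s + d + 1) *
      ∏ j ∈ Finset.range i, (t / secondQuotient a (s + 2 + (d - j))) := by
  induction i with
  | zero => simp
  | succ i ih =>
    have hsucc : coeffRatio a (s + d + 1 - i) =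
        secondQuotient a (s + 2 + (d - i)) * coeffRatio a (s + d + 1 - (i + 1)) := by
      rw [show s + d + 1 - i = s + d + 1 - (i + 1) + 1 by lia, coeffRatio_succ ha]
      congr 2
      lia
    have hq := secondQuotient_pos ha (s + 2 + (d - i))
    rw [Finset.prod_range_succ, ← mul_assoc, ← ih (by lia), hsucc]
    field_simp
    ring

theorem term_sub_eq {t u : ℝ} (ht : t ≠ 0) (hu : u ≠ 0) (s d : ℕ) {i : ℕ} (hi : i ≤ d + 2) :
    a (s + d + 2 - i) * (coeffRatio a (s + d + 1) / u) ^ (s + d + 2 - i) =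
      a (s + d + 2) * (coeffRatio a (s + d + 1) / u) ^ (s + d + 2) * (u ^ i / t ^ i.choose 2 *
        dampingWeight (fun j => t / secondQuotient a (s + 2 + (d - j))) i) := by
  set y := coeffRatio a (s + d + 1) / u
  have hp := coeffRatio_pos ha (s + d + 1)
  have hy : y ≠ 0 := div_ne_zero hp.ne' hu
  induction i with
  | zero => simp [dampingWeight_zero]
  | succ i ih =>
    have hratio := coeffRatio_sub_mul_pow ha t s d (show i ≤ d + 1 by lia)
    have hterm := term_succ_mul_coeffRatio ha y (s + d + 1 - i)
    rw [show s + d + 1 - i + 1 = s + d + 2 - i by lia, ih (by lia)] at hterm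
    rw [show s + d + 2 - (i + 1) = s + d + 1 - i by lia, dampingWeight_succ,
      Nat.choose_succ_succ' i 1, Nat.choose_one_right, ← mul_left_inj' hy, ← hterm,
      eq_div_of_mul_eq (pow_ne_zero i ht) hratio,
      show coeffRatio a (s + d + 1) = y * u from (div_mul_cancel₀ _ hu).symm]
    ring

theorem mul_coeffRatio_pow (K : ℕ) (R : ℝ) :
    a K * R ^ K = a 0 * ∏ j ∈ Finset.range K, (R / coeffRatio a j) := by
  induction K with
  | zero => simp
  | succ K ih =>
    have hp := (coeffRatio_pos ha K).ne'
    rw [Finset.prod_range_succ, ← mul_assoc, ← ih, ← coeffRatio_mul_succ ha K]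
    field_simp
    ring

end CoeffRatio

section SignPattern

variable {a : ℕ → ℝ} {s m : ℕ} {t u : ℝ}

theorem sum_alternating_term_nonpos (ha : ∀ k, 0 < a k)
    (hq : MonotoneOn (secondQuotient a) (Set.Ici (s + 2))) (ht : 3 ≤ t)
    (htq : t ≤ secondQuotient a (s + 2)) (hu : u ∈ Set.Icc 1 t)
    (hwindow : thetaWindow (2 * m + 2) t u ≤ 0) :
    ∑ i ∈ Finset.range (2 * m + 3),
      (-1) ^ i * (a (s + i) * (coeffRatio a (s + 2 * m + 1) / u) ^ (s + i)) ≤ 0 := by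
  have hu0 : 0 < u := zero_lt_one.trans_le hu.1
  have ht0 : 0 < t := by linarith
  set y := coeffRatio a (s + 2 * m + 1) / u
  have hy : 0 < y := div_pos (coeffRatio_pos ha _) hu0
  set r : ℕ → ℝ := fun j => t / secondQuotient a (s + 2 + (2 * m - j))
  have hqt (j : ℕ) : t ≤ secondQuotient a (s + 2 + j) :=
    htq.trans (hq (Set.mem_Ici.2 le_rfl) (Set.mem_Ici.2 (by lia)) (by lia))
  have hr0 (j : ℕ) : 0 ≤ r j := div_nonneg ht0.le (secondQuotient_pos ha _).le
  have hr1 (j : ℕ) : r j ≤ 1 := div_le_one_of_le₀ (hqt _) (secondQuotient_pos ha _).le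
  have hr : Monotone r := fun i j hij =>
    div_le_div_of_nonneg_left ht0.le (secondQuotient_pos ha _)
      (hq (Set.mem_Ici.2 (by lia)) (Set.mem_Ici.2 (by lia)) (by lia))
  have hdamped := sum_mul_le_thetaWindow ht hu0.le hu.2 (dampingWeight_zero r)
    (dampingWeight_one r) (dampingWeight_nonneg hr0) (dampingWeight_le_one hr0 hr1)
    (fun i hi => dampingWeight_cube_le hr0 hr1 hr hi) (2 * m + 1)
  have hreflect : ∑ i ∈ Finset.range (2 * m + 3), (-1) ^ i * (a (s + i) * y ^ (s + i)) =
      a (s + 2 * m + 2) * y ^ (s + 2 * m + 2) * ∑ i ∈ Finset.range (2 * m + 3),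
        (-1) ^ i * (u ^ i / t ^ i.choose 2 * dampingWeight r i) := by
    rw [← Finset.sum_range_reflect, Finset.mul_sum]
    refine Finset.sum_congr rfl fun i hi => ?_
    have hi : i ≤ 2 * m + 2 := Nat.lt_succ_iff.1 (Finset.mem_range.1 hi)
    have hsign : (-1 : ℝ) ^ (2 * m + 3 - 1 - i) = (-1) ^ i :=
      neg_one_pow_congr (by grind)
    rw [hsign, show s + (2 * m + 3 - 1 - i) = s + 2 * m + 2 - i by lia,
      term_sub_eq ha ht0.ne' hu0.ne' s (2 * m) hi, mul_left_comm]
  rw [hreflect]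
  exact mul_nonpos_of_nonneg_of_nonpos (mul_pos (ha _) (pow_pos hy _)).le
    (hdamped.trans hwindow)

theorem coeffRatio_div_mem_Icc (ha : ∀ k, 0 < a k) {k : ℕ} (htq : t ≤ secondQuotient a (k + 2))
    (hu : u ∈ Set.Icc 1 t) :
    coeffRatio a (k + 1) / u ∈ Set.Icc (coeffRatio a k) (coeffRatio a (k + 1)) := by
  have hp := coeffRatio_pos ha k
  constructor
  · rw [le_div_iff₀ (zero_lt_one.trans_le hu.1), coeffRatio_succ ha, mul_comm]
    exact mul_le_mul_of_nonneg_right (hu.2.trans htq) hp.le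
  · exact div_le_self (coeffRatio_pos ha _).le hu.1

theorem exists_sign_of_thetaWindow_nonpos (ha : ∀ k, 0 < a k) (hp : Monotone (coeffRatio a))
    (hq : MonotoneOn (secondQuotient a) (Set.Ici (s + 2))) (ht : 3 ≤ t)
    (htq : t ≤ secondQuotient a (s + 2)) (hu : u ∈ Set.Icc 1 t)
    (hwindow : thetaWindow (2 * m + 2) t u ≤ 0) {g : ℝ → ℝ}
    (hg : ∀ x, HasSum (fun k => a k * x ^ k) (g x)) :
    ∃ y ∈ Set.Icc (coeffRatio a (s + 2 * m)) (coeffRatio a (s + 2 * m + 1)),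
      0 < (-1) ^ (s + 1) * g (-y) := by
  have hqt (j : ℕ) (hj : s + 2 ≤ j) : t ≤ secondQuotient a j :=
    htq.trans (hq (Set.mem_Ici.2 le_rfl) (Set.mem_Ici.2 hj) hj)
  set y := coeffRatio a (s + 2 * m + 1) / u
  obtain ⟨hple, hley⟩ := coeffRatio_div_mem_Icc ha (hqt (s + 2 * m + 2) (by lia)) hu
  have hy : 0 < y := (coeffRatio_pos ha _).trans_le hple
  refine ⟨y, ⟨hple, hley⟩, ?_⟩
  have hsum : HasSum (fun j => (-1) ^ j * (a j * y ^ j)) (g (-y)) :=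
    (hg (-y)).congr_fun fun j => by rw [neg_pow]; ring
  have hblock := alternating_block_le hsum (s := s) (m := m + 1)
    (fun j _ => (mul_pos (ha j) (pow_pos hy j)).le)
    (fun j hj => term_le_succ ha hy.le ((hp (by lia)).trans hple))
    (antitoneOn_nat_Ici_of_succ_le fun j hj => term_succ_le ha hy.le (hley.trans (hp (by lia))))
  have hlt : y < coeffRatio a (s + 2 * m + 3) := by
    have hpos := coeffRatio_pos ha (s + 2 * m + 1)
    calc y ≤ coeffRatio a (s + 2 * m + 1) := hley
      _ < secondQuotient a (s + 2 * m + 1 + 2) * coeffRatio a (s + 2 * m + 1) :=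
        lt_mul_of_one_lt_left hpos (by linarith [hqt (s + 2 * m + 1 + 2) (by lia)])
      _ = coeffRatio a (s + 2 * m + 2) := (coeffRatio_succ ha _).symm
      _ ≤ coeffRatio a (s + 2 * m + 3) := hp (by lia)
  have hstrict := term_succ_lt ha hy hlt
  have hwin : ∑ i ∈ Finset.range (2 * m + 3), (-1) ^ i * (a (s + i) * y ^ (s + i)) ≤ 0 :=
    sum_alternating_term_nonpos ha hq ht htq hu hwindow
  simp only [mul_add, mul_one, add_assoc, Nat.reduceAdd] at hblock hstrict hwin
  linarith

end SignPattern

theorem exists_strictAnti_zeros {a : ℕ → ℝ} (ha : ∀ k, 0 < a k) (hp : Monotone (coeffRatio a))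
    {s m : ℕ} (hq : MonotoneOn (secondQuotient a) (Set.Ici (s + 2)))
    (hc : thetaConst (2 * m + 2) ≤ secondQuotient a (s + 2)) {g : ℝ → ℝ} (hcont : Continuous g)
    (hg : ∀ x, HasSum (fun k => a k * x ^ k) (g x)) :
    ∃ ξ : ℕ → ℝ, StrictAnti ξ ∧
      ∀ i, g (ξ i) = 0 ∧ |ξ i| ≤ coeffRatio a (s + 2 * m + 2 + i) := by
  obtain ⟨ht, u, hu, hwindow⟩ :=
    three_le_thetaConst_and_exists_thetaWindow_eq_zero (show 2 ≤ 2 * m + 2 by lia)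
  have hsign (i : ℕ) : ∃ y ∈ Set.Icc (coeffRatio a (s + i + 2 * m))
      (coeffRatio a (s + i + 2 * m + 1)), 0 < (-1) ^ (s + i + 1) * g (-y) :=
    exists_sign_of_thetaWindow_nonpos ha hp (hq.mono (Set.Ici_subset_Ici.2 (by lia))) ht
      (hc.trans (hq (Set.mem_Ici.2 le_rfl) (Set.mem_Ici.2 (by lia)) (by lia))) hu hwindow.le hg
  choose y hy hysign using hsign
  have hymono (i : ℕ) : y i ≤ y (i + 1) := (hy i).2.trans ((hp (by lia)).trans (hy (i + 1)).1)
  have hzero (i : ℕ) : ∃ ξ ∈ Set.Ioo (-y (i + 1)) (-y i), g ξ = 0 :=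
    exists_zero_of_alternating hcont (neg_le_neg (hymono i)) (hysign i) (hysign (i + 1))
  choose ξ hξ hξzero using hzero
  refine ⟨ξ, strictAnti_nat_of_succ_lt fun i => (hξ (i + 1)).2.trans (hξ i).1,
    fun i => ⟨hξzero i, ?_⟩⟩
  have hypos : 0 < y i := (coeffRatio_pos ha _).trans_le (hy i).1
  calc |ξ i| = -ξ i := abs_of_neg ((hξ i).2.trans (neg_neg_of_pos hypos))
    _ ≤ y (i + 1) := (neg_lt.1 (hξ i).1).le
    _ ≤ coeffRatio a (s + 2 * m + 2 + i) := (hy (i + 1)).2.trans (hp (by lia))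

section Growth

variable {a : ℕ → ℝ} (ha : ∀ k, 0 < a k) (hp : Monotone (coeffRatio a))
include ha hp

theorem term_le_term_succ_of_coeffRatio_le {K : ℕ} {y : ℝ} (hKy : coeffRatio a K ≤ y)
    (hyK : y ≤ coeffRatio a (K + 1)) (j : ℕ) : a j * y ^ j ≤ a (K + 1) * y ^ (K + 1) := by
  have hy : 0 ≤ y := (coeffRatio_pos ha K).le.trans hKy
  have hmono : MonotoneOn (fun k => a k * y ^ k) (Set.Iic (K + 1)) :=
    monotoneOn_of_le_add_one Set.ordConnected_Iic fun k _ _ hk =>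
      term_le_succ ha hy ((hp (Nat.le_of_succ_le_succ hk)).trans hKy)
  have hanti : AntitoneOn (fun k => a k * y ^ k) (Set.Ici (K + 1)) :=
    antitoneOn_nat_Ici_of_succ_le fun k hk => term_succ_le ha hy (hyK.trans (hp hk))
  rcases le_total j (K + 1) with hj | hj
  · exact hmono hj (Set.mem_Iic.2 le_rfl) hj
  · exact hanti (Set.mem_Ici.2 le_rfl) hj hj

theorem term_sub_le_mul_half_pow {K : ℕ} {R : ℝ} (hKR : 2 * coeffRatio a K ≤ R)
    (hRK : R ≤ 2 * coeffRatio a (K + 1)) {i : ℕ} (hi : i ≤ K + 1) :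
    a (K + 1 - i) * R ^ (K + 1 - i) ≤ a (K + 1) * R ^ (K + 1) * (1 / 2) ^ i := by
  have hmax := term_le_term_succ_of_coeffRatio_le ha hp (K := K) (y := R / 2) (by linarith)
    (by linarith) (K + 1 - i)
  calc a (K + 1 - i) * R ^ (K + 1 - i)
      = a (K + 1 - i) * (R / 2) ^ (K + 1 - i) * 2 ^ (K + 1 - i) := by
        rw [mul_assoc, ← mul_pow, div_mul_cancel₀ R two_ne_zero]
    _ ≤ a (K + 1) * (R / 2) ^ (K + 1) * 2 ^ (K + 1 - i) := by gcongr
    _ = a (K + 1) * R ^ (K + 1) * (1 / 2) ^ i := by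
        rw [div_pow R, pow_sub₀ 2 two_ne_zero hi, one_div, inv_pow]
        field_simp

theorem term_add_le_mul_half_pow {K : ℕ} {R : ℝ} (hKR : coeffRatio a K ≤ 2 * R)
    (hRK : 2 * R ≤ coeffRatio a (K + 1)) (i : ℕ) :
    a (K + 1 + i) * R ^ (K + 1 + i) ≤ a (K + 1) * R ^ (K + 1) * (1 / 2) ^ i := by
  have hpow (j : ℕ) : R ^ j = (2 * R) ^ j * (1 / 2) ^ j := by
    rw [← mul_pow]
    congr 1
    ring
  calc a (K + 1 + i) * R ^ (K + 1 + i)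
      = a (K + 1 + i) * (2 * R) ^ (K + 1 + i) * (1 / 2) ^ (K + 1 + i) := by rw [hpow, mul_assoc]
    _ ≤ a (K + 1) * (2 * R) ^ (K + 1) * (1 / 2) ^ (K + 1 + i) :=
        mul_le_mul_of_nonneg_right (term_le_term_succ_of_coeffRatio_le ha hp hKR hRK _)
          (by positivity)
    _ = a (K + 1) * R ^ (K + 1) * (1 / 2) ^ i := by
        rw [hpow (K + 1), pow_add (1 / 2)]
        ring

/-- Comparing the maximal terms at half and at twice the radius gives geometric decay on both sides
of the maximal term. -/
theorem hasSum_term_le_four_mul {K : ℕ} (hleft : 2 * coeffRatio a K ≤ coeffRatio a (K + 1))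
    (hright : 2 * coeffRatio a (K + 1) ≤ coeffRatio a (K + 2)) {S : ℝ}
    (hS : HasSum (fun k => a k * coeffRatio a (K + 1) ^ k) S) :
    S ≤ 4 * (a (K + 1) * coeffRatio a (K + 1) ^ (K + 1)) := by
  set R := coeffRatio a (K + 1)
  have hR : 0 < R := coeffRatio_pos ha (K + 1)
  set M := a (K + 1) * R ^ (K + 1)
  have hM : 0 < M := mul_pos (ha _) (pow_pos hR _)
  have hM_eq : a (K + 2) * R ^ (K + 2) = M := by
    rw [pow_succ' R, ← mul_assoc, mul_comm (a _), coeffRatio_mul_succ ha (K + 1)]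
  have hhead (i : ℕ) (hi : i ≤ K + 1) : a (K + 1 - i) * R ^ (K + 1 - i) ≤ M * (1 / 2) ^ i :=
    term_sub_le_mul_half_pow ha hp hleft (by linarith) hi
  have htail (i : ℕ) : a (K + 2 + i) * R ^ (K + 2 + i) ≤ M * (1 / 2) ^ i :=
    (term_add_le_mul_half_pow ha hp (by linarith) hright i).trans_eq (by rw [hM_eq])
  have hhead_sum : ∑ i ∈ Finset.range (K + 2), a i * R ^ i ≤ M * 2 := by
    rw [← Finset.sum_range_reflect]
    calc ∑ i ∈ Finset.range (K + 2), a (K + 2 - 1 - i) * R ^ (K + 2 - 1 - i)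
        ≤ ∑ i ∈ Finset.range (K + 2), M * (1 / 2) ^ i :=
          Finset.sum_le_sum fun i hi => hhead i (Nat.lt_succ_iff.1 (Finset.mem_range.1 hi))
      _ ≤ M * 2 := by
          rw [← Finset.mul_sum]
          gcongr
          exact sum_geometric_two_le _
  have htail_sum := (hasSum_nat_add_iff' (K + 2)).2 hS
  have htail_le := hasSum_le (fun i => by simpa only [add_comm i] using htail i) htail_sum
    (hasSum_geometric_two.mul_left M)
  linarith

theorem norm_le_of_norm_eq_coeffRatio {f : ℂ → ℂ}
    (hf : ∀ z : ℂ, HasSum (fun k : ℕ => (a k : ℂ) * z ^ k) (f z)) {K : ℕ}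
    (hleft : 2 * coeffRatio a K ≤ coeffRatio a (K + 1))
    (hright : 2 * coeffRatio a (K + 1) ≤ coeffRatio a (K + 2)) {z : ℂ}
    (hz : ‖z‖ = coeffRatio a (K + 1)) :
    ‖f z‖ ≤ 4 * a 0 * ∏ j ∈ Finset.range (K + 1), (coeffRatio a (K + 1) / coeffRatio a j) := by
  have hnorm (k : ℕ) : ‖(a k : ℂ) * z ^ k‖ = a k * coeffRatio a (K + 1) ^ k := by
    rw [norm_mul, norm_pow, hz, Complex.norm_real, Real.norm_of_nonneg (ha k).le]
  have hsum : HasSum (fun k => a k * coeffRatio a (K + 1) ^ k) (∑' k, ‖(a k : ℂ) * z ^ k‖) :=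
    (hf z).summable.norm.hasSum.congr_fun fun k => (hnorm k).symm
  rw [mul_assoc, ← mul_coeffRatio_pow ha, ← (hf z).tsum_eq]
  exact (norm_tsum_le_tsum_norm (hf z).summable.norm).trans
    (hasSum_term_le_four_mul ha hp hleft hright hsum)

end Growth

theorem tendsto_coeffRatio_atTop {a : ℕ → ℝ} (ha : ∀ k, 0 < a k) {s : ℕ}
    (hdouble : ∀ k, s ≤ k → 2 * coeffRatio a k ≤ coeffRatio a (k + 1)) :
    Filter.Tendsto (coeffRatio a) Filter.atTop Filter.atTop := by
  rw [← Filter.tendsto_add_atTop_iff_nat s]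
  refine tendsto_atTop_of_geom_le (coeffRatio_pos ha _) one_lt_two fun n => ?_
  rw [add_right_comm]
  exact hdouble _ (by lia)

section PowerSeries

theorem analyticAt_of_hasSum {𝕜 : Type*} [RCLike 𝕜] {c : ℕ → 𝕜} {f : 𝕜 → 𝕜}
    (hf : ∀ z, HasSum (fun k => c k * z ^ k) (f z)) (z : 𝕜) : AnalyticAt 𝕜 f z := by
  have hradius : (FormalMultilinearSeries.ofScalars 𝕜 c).radius = ⊤ :=
    FormalMultilinearSeries.radius_eq_top_of_summable_norm _ fun r =>
      (hf ((r : ℝ) : 𝕜)).summable.norm.congr fun k => by simp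
  have hball : HasFPowerSeriesOnBall f (FormalMultilinearSeries.ofScalars 𝕜 c) 0 ⊤ :=
    ⟨hradius.ge, ENNReal.zero_lt_top, fun {y} _ => by
      simpa [FormalMultilinearSeries.ofScalars_apply_eq, mul_comm] using hf y⟩
  exact hball.analyticAt_of_mem (by simp)

theorem hasSum_re_of_hasSum_ofReal {a : ℕ → ℝ} {f : ℂ → ℂ}
    (hf : ∀ z : ℂ, HasSum (fun k : ℕ => (a k : ℂ) * z ^ k) (f z)) (x : ℝ) :
    HasSum (fun k => a k * x ^ k) (f x).re :=
  (Complex.reCLM.hasSum (hf x)).congr_fun fun k => by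
    rw [Complex.reCLM_apply, ← Complex.ofReal_pow, ← Complex.ofReal_mul, Complex.ofReal_re]

theorem apply_zero_eq_of_hasSum {𝕜 : Type*} [RCLike 𝕜] {c : ℕ → 𝕜} {f : 𝕜 → 𝕜}
    (hf : ∀ z, HasSum (fun k => c k * z ^ k) (f z)) : f 0 = c 0 := by
  refine (hf 0).unique ?_
  simpa using hasSum_single (f := fun k => c k * (0 : 𝕜) ^ k) 0 fun k hk => by simp [hk]

end PowerSeries

section Jensen

open Metric MeromorphicOn

theorem circleAverage_log_norm_le {c : ℂ} {R M : ℝ} {f : ℂ → ℂ}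
    (hf : AnalyticOnNhd ℂ f (sphere c |R|)) (hM : 1 ≤ M) (hbound : ∀ z ∈ sphere c |R|, ‖f z‖ ≤ M) :
    Real.circleAverage (fun z => Real.log ‖f z‖) c R ≤ Real.log M := by
  refine Real.circleAverage_mono_on_of_le_circle
    hf.meromorphicOn.circleIntegrable_log_norm fun z hz => ?_
  rcases eq_or_ne (f z) 0 with hzero | hzero
  · simpa [hzero] using Real.log_nonneg hM
  · exact Real.log_le_log (norm_pos_iff.2 hzero) (hbound z hz)

theorem divisor_eq_analyticOrderNatAt {f : ℂ → ℂ} {U : Set ℂ} (hf : AnalyticOnNhd ℂ f U) {z : ℂ}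
    (hz : z ∈ U) : divisor f U z = analyticOrderNatAt f z := by
  rw [hf.divisor_apply hz, analyticOrderNatAt]
  cases analyticOrderAt f z using ENat.recTopCoe <;> simp

theorem sum_analyticOrderNatAt_mul_log_le {c : ℂ} {R M : ℝ} {f : ℂ → ℂ}
    (hf : AnalyticOnNhd ℂ f (closedBall c R)) (hc : f c ≠ 0) (hR : 0 < R) (hM : 1 ≤ M)
    (hbound : ∀ z ∈ sphere c R, ‖f z‖ ≤ M) {A : Finset ℂ} (hA : ∀ w ∈ A, w ∈ closedBall c R) :
    ∑ w ∈ A, analyticOrderNatAt f w * Real.log (R / ‖c - w‖) + Real.log ‖f c‖ ≤ Real.log M := by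
  rw [← abs_of_pos hR] at hf hbound hA
  have hjensen := hf.circleAverage_log_norm hR.ne' hc
  have haverage := circleAverage_log_norm_le (hf.mono sphere_subset_closedBall) hM hbound
  set D := divisor f (closedBall c |R|)
  set F : ℂ → ℝ := fun w => D w * Real.log (R * ‖c - w‖⁻¹)
  have hF_nonneg (w : ℂ) : 0 ≤ F w := by
    by_cases hw : w ∈ closedBall c |R|
    · refine mul_nonneg (Int.cast_nonneg (hf.divisor_nonneg w)) ?_
      rcases eq_or_ne w c with rfl | hwc
      · simp
      · rw [mem_closedBall, dist_comm, dist_eq_norm, abs_of_pos hR] at hw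
        exact Real.log_nonneg
          ((one_le_div (norm_pos_iff.2 (sub_ne_zero.2 hwc.symm))).2 hw)
    · simp [F, D, Function.locallyFinsuppWithin.apply_eq_zero_of_notMem _ hw]
  have hF_finite : (Function.support F).Finite :=
    (D.finiteSupport (isCompact_closedBall _ _)).subset fun w hw hD => hw (by simp [F, hD])
  have hsum_le : ∑ w ∈ A, F w ≤ ∑ᶠ w, F w := by
    rw [finsum_eq_sum_of_support_subset F (s := hF_finite.toFinset ∪ A) (by simp)]
    exact Finset.sum_le_sum_of_subset_of_nonneg Finset.subset_union_right
      fun w _ _ => hF_nonneg w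
  have hsum_eq : ∑ w ∈ A, analyticOrderNatAt f w * Real.log (R / ‖c - w‖) = ∑ w ∈ A, F w :=
    Finset.sum_congr rfl fun w hw => by
      simp only [F, D, divisor_eq_analyticOrderNatAt hf (hA w hw), Int.cast_natCast, div_eq_mul_inv]
  linarith

end Jensen

section ZeroCounting

theorem le_of_eventually_mul_le_mul_add {l : ℕ → ℝ}
    (hl : Filter.Tendsto l Filter.atTop Filter.atTop) {c d B : ℝ}
    (h : ∀ᶠ n in Filter.atTop, c * l n ≤ d * l n + B) : c ≤ d := by
  by_contra! hlt
  have hlarge := (hl.const_mul_atTop (sub_pos.2 hlt)).eventually_gt_atTop B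
  obtain ⟨n, hn, hBn⟩ := (h.and hlarge).exists
  linarith

variable {f : ℂ → ℂ} (hf : ∀ z, AnalyticAt ℂ f z)
include hf

theorem analyticOrderAt_ne_top_of_apply_ne_zero {w₀ : ℂ} (hw₀ : f w₀ ≠ 0) (w : ℂ) :
    analyticOrderAt f w ≠ ⊤ := by
  have hfU : AnalyticOnNhd ℂ f Set.univ := fun z _ => hf z
  refine hfU.analyticOrderAt_ne_top_of_isPreconnected isPreconnected_univ (Set.mem_univ w₀)
    (Set.mem_univ w) ?_
  simp [(hf w₀).analyticOrderAt_eq_zero.2 hw₀]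

theorem one_le_analyticOrderNatAt {w₀ w : ℂ} (hw₀ : f w₀ ≠ 0) (hw : f w = 0) :
    1 ≤ analyticOrderNatAt f w := by
  rw [← Nat.cast_le (α := ℕ∞), Nat.cast_analyticOrderNatAt
    (analyticOrderAt_ne_top_of_apply_ne_zero hf hw₀ w), Nat.cast_one, Order.one_le_iff_ne_zero]
  exact mt (hf w).analyticOrderAt_eq_zero.1 (not_not_intro hw)

variable (h0 : f 0 ≠ 0) {p : ℕ → ℝ} (hp0 : ∀ k, 0 < p k) (hp : Monotone p) {C : ℝ} (hC : 1 ≤ C)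
  {N : ℕ} {ξ : ℕ → ℂ} (hinj : Function.Injective ξ)
  (hξ : ∀ i, f (ξ i) = 0 ∧ ‖ξ i‖ ≤ p (N + i))
include h0 hp0 hp hξ

theorem sum_log_div_le_sum_analyticOrderNatAt_mul_log (L : ℕ) :
    ∑ i ∈ Finset.range L, Real.log (p (N + L) / p (N + i)) ≤
      ∑ i ∈ Finset.range L, analyticOrderNatAt f (ξ i) * Real.log (p (N + L) / ‖ξ i‖) := by
  refine Finset.sum_le_sum fun i hi => ?_
  have hξ0 : 0 < ‖ξ i‖ := norm_pos_iff.2 fun h => h0 (h ▸ (hξ i).1)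
  have hle : p (N + i) ≤ p (N + L) := hp (by grind)
  have hlog : Real.log (p (N + L) / p (N + i)) ≤ Real.log (p (N + L) / ‖ξ i‖) :=
    Real.log_le_log (div_pos (hp0 _) (hp0 _))
      (div_le_div_of_nonneg_left (hp0 _).le hξ0 (hξ i).2)
  have hlog_nonneg : 0 ≤ Real.log (p (N + L) / p (N + i)) :=
    Real.log_nonneg ((one_le_div (hp0 _)).2 hle)
  have hone : (1 : ℝ) ≤ analyticOrderNatAt f (ξ i) :=
    Nat.one_le_cast.2 (one_le_analyticOrderNatAt hf h0 (hξ i).1)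
  exact hlog.trans (le_mul_of_one_le_left (hlog_nonneg.trans hlog) hone)

include hC hinj

theorem sum_analyticOrderNatAt_mul_log_le_of_zeros {L : ℕ}
    (hbound : ∀ z, ‖z‖ = p (N + L) →
      ‖f z‖ ≤ C * ∏ j ∈ Finset.range (N + L), (p (N + L) / p j)) {A : Finset ℂ}
    (hA : ∀ w ∈ A, ‖w‖ ≤ p (N + L)) (hξA : ∀ i, ξ i ∉ A) :
    ∑ w ∈ A, analyticOrderNatAt f w * Real.log (p (N + L) / ‖w‖) + Real.log ‖f 0‖ ≤
      Real.log C + ∑ j ∈ Finset.range N, Real.log (p (N + L) / p j) := by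
  set R := p (N + L)
  have hratio_pos (j : ℕ) : 0 < R / p j := div_pos (hp0 _) (hp0 _)
  have hprod : 1 ≤ ∏ j ∈ Finset.range (N + L), (R / p j) :=
    Finset.one_le_prod fun j hj => (one_le_div (hp0 j)).2 (hp (Finset.mem_range.1 hj).le)
  have hdisj : Disjoint A ((Finset.range L).image ξ) := by
    rw [Finset.disjoint_right]
    simpa using fun i _ => hξA i
  have hjensen := sum_analyticOrderNatAt_mul_log_le (c := 0) (R := R)
    (A := A ∪ (Finset.range L).image ξ) (fun z _ => hf z) h0 (hp0 _)
    (one_le_mul_of_one_le_of_one_le hC hprod) (fun z hz => hbound z (by simpa using hz))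
    (fun w hw => by
      rw [mem_closedBall_zero_iff]
      rcases Finset.mem_union.1 hw with hw | hw
      · exact hA w hw
      · obtain ⟨i, hi, rfl⟩ := Finset.mem_image.1 hw
        exact (hξ i).2.trans (hp (by grind)))
  have hzeros := sum_log_div_le_sum_analyticOrderNatAt_mul_log hf h0 hp0 hp hξ L
  have hlog_prod : Real.log (C * ∏ j ∈ Finset.range (N + L), (R / p j)) = Real.log C +
      (∑ j ∈ Finset.range N, Real.log (R / p j) +
        ∑ i ∈ Finset.range L, Real.log (R / p (N + i))) := by
    rw [Real.log_mul (by linarith) (by linarith),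
      Real.log_prod fun j _ => (hratio_pos j).ne', Finset.sum_range_add]
  rw [Finset.sum_union hdisj, Finset.sum_image hinj.injOn, hlog_prod] at hjensen
  simp only [zero_sub, norm_neg] at hjensen
  linarith

theorem sum_analyticOrderNatAt_le (hlim : Filter.Tendsto p Filter.atTop Filter.atTop)
    (hbound : ∀ᶠ K in Filter.atTop, ∀ z, ‖z‖ = p K →
      ‖f z‖ ≤ C * ∏ j ∈ Finset.range K, (p K / p j)) {A : Finset ℂ} (hξA : ∀ i, ξ i ∉ A) :
    ∑ w ∈ A, analyticOrderNatAt f w ≤ N := by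
  rw [← Nat.cast_le (α := ℝ), Nat.cast_sum]
  have hshift : Filter.Tendsto (fun L => p (N + L)) Filter.atTop Filter.atTop := by
    simpa only [add_comm N] using (Filter.tendsto_add_atTop_iff_nat N).2 hlim
  have hlarge : ∀ᶠ L in Filter.atTop, ∀ w ∈ A, ‖w‖ ≤ p (N + L) :=
    (Filter.eventually_all_finset A).2 fun w _ => hshift.eventually_ge_atTop ‖w‖
  have hbound' := ((Filter.tendsto_add_atTop_nat N).eventually hbound)
  refine le_of_eventually_mul_le_mul_add (Real.tendsto_log_atTop.comp hshift)
    (B := Real.log C - ∑ j ∈ Finset.range N, Real.log (p j) +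
      ∑ w ∈ A, analyticOrderNatAt f w * Real.log ‖w‖ - Real.log ‖f 0‖) ?_
  filter_upwards [hlarge, hbound'] with L hAL hL
  rw [add_comm L] at hL
  have hjensen := sum_analyticOrderNatAt_mul_log_le_of_zeros hf h0 hp0 hp hC hinj hξ hL hAL hξA
  have horder (w : ℂ) : analyticOrderNatAt f w * Real.log (p (N + L) / ‖w‖) =
      analyticOrderNatAt f w * Real.log (p (N + L)) - analyticOrderNatAt f w * Real.log ‖w‖ := by
    rcases eq_or_ne w 0 with rfl | hw
    · simp [analyticOrderNatAt, (hf 0).analyticOrderAt_eq_zero.2 h0]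
    · rw [Real.log_div (hp0 _).ne' (norm_ne_zero_iff.2 hw), mul_sub]
  have hlog (j : ℕ) : Real.log (p (N + L) / p j) = Real.log (p (N + L)) - Real.log (p j) :=
    Real.log_div (hp0 _).ne' (hp0 j).ne'
  simp only [horder, hlog, Finset.sum_sub_distrib, ← Finset.sum_mul, Finset.sum_const,
    Finset.card_range, nsmul_eq_mul] at hjensen
  simp only [Function.comp_apply]
  linarith

theorem finite_and_finsum_analyticOrderAt_le
    (hlim : Filter.Tendsto p Filter.atTop Filter.atTop)
    (hbound : ∀ᶠ K in Filter.atTop, ∀ z, ‖z‖ = p K →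
      ‖f z‖ ≤ C * ∏ j ∈ Finset.range K, (p K / p j)) {s : Set ℂ} (hs : ∀ w ∈ s, f w = 0)
    (hξs : ∀ i, ξ i ∉ s) : s.Finite ∧ ∑ᶠ w ∈ s, analyticOrderAt f w ≤ N := by
  have hsum {A : Finset ℂ} (hA : ↑A ⊆ s) : ∑ w ∈ A, analyticOrderNatAt f w ≤ N :=
    sum_analyticOrderNatAt_le hf h0 hp0 hp hC hinj hξ hlim hbound fun i hi => hξs i (hA hi)
  have hfinite : s.Finite := by
    by_contra hinf
    obtain ⟨A, hA, hcard⟩ := Set.Infinite.exists_subset_card_eq hinf (N + 1)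
    have hcard_le := Finset.card_nsmul_le_sum A (analyticOrderNatAt f) 1
      fun w hw => one_le_analyticOrderNatAt hf h0 (hs w (hA hw))
    rw [hcard, smul_eq_mul, mul_one] at hcard_le
    exact absurd (hcard_le.trans (hsum hA)) (by lia)
  refine ⟨hfinite, ?_⟩
  rw [finsum_mem_eq_finite_toFinset_sum _ hfinite]
  calc ∑ w ∈ hfinite.toFinset, analyticOrderAt f w
      = ∑ w ∈ hfinite.toFinset, (analyticOrderNatAt f w : ℕ∞) :=
        Finset.sum_congr rfl fun w _ =>
          (Nat.cast_analyticOrderNatAt (analyticOrderAt_ne_top_of_apply_ne_zero hf h0 w)).symm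
    _ = ((∑ w ∈ hfinite.toFinset, analyticOrderNatAt f w : ℕ) : ℕ∞) := (Nat.cast_sum _ _).symm
    _ ≤ N := Nat.cast_le.2 (hsum (by simp))

end ZeroCounting

section PositiveCoefficients

variable {a : ℕ → ℝ} (ha : ∀ k, 0 < a k)
include ha

theorem two_mul_coeffRatio_le {s : ℕ} (hs : 2 ≤ secondQuotient a (s + 2))
    (hq : MonotoneOn (secondQuotient a) (Set.Ici (s + 2))) {k : ℕ} (hk : s ≤ k) :
    2 * coeffRatio a k ≤ coeffRatio a (k + 1) := by
  have hk' : s + 2 ≤ k + 2 := by lia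
  rw [coeffRatio_succ ha]
  exact mul_le_mul_of_nonneg_right (hs.trans (hq Set.self_mem_Ici hk' hk')) (coeffRatio_pos ha k).le

variable {f : ℂ → ℂ} (hf : ∀ z : ℂ, HasSum (fun k : ℕ => (a k : ℂ) * z ^ k) (f z))

include hf in
theorem eventually_norm_le_mul_prod_coeffRatio (hp : Monotone (coeffRatio a)) {s : ℕ}
    (hdouble : ∀ k, s ≤ k → 2 * coeffRatio a k ≤ coeffRatio a (k + 1)) :
    ∀ᶠ K in Filter.atTop, ∀ z, ‖z‖ = coeffRatio a K →
      ‖f z‖ ≤ max 1 (4 * a 0) * ∏ j ∈ Finset.range K, (coeffRatio a K / coeffRatio a j) := by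
  filter_upwards [Filter.eventually_ge_atTop (s + 1)] with K hK z hz
  obtain ⟨K, rfl⟩ := Nat.exists_eq_add_of_le' (show 1 ≤ K by lia)
  refine (norm_le_of_norm_eq_coeffRatio ha hp hf (hdouble K (by lia)) (hdouble _ (by lia))
    hz).trans ?_
  exact mul_le_mul_of_nonneg_right (le_max_right _ _)
    (Finset.prod_nonneg fun j _ => (div_pos (coeffRatio_pos ha _) (coeffRatio_pos ha j)).le)

include hf in
theorem exists_injective_ofReal_zeros (hp : Monotone (coeffRatio a)) {s m : ℕ}
    (hq : MonotoneOn (secondQuotient a) (Set.Ici (s + 2)))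
    (hc : thetaConst (2 * m + 2) ≤ secondQuotient a (s + 2)) :
    ∃ ξ : ℕ → ℝ, Function.Injective (fun i => (ξ i : ℂ)) ∧
      ∀ i, f (ξ i) = 0 ∧ ‖(ξ i : ℂ)‖ ≤ coeffRatio a (s + 2 * m + 2 + i) := by
  have hsum := hasSum_re_of_hasSum_ofReal hf
  have hcont : Continuous fun x : ℝ => (f x).re :=
    Complex.continuous_re.comp <|
      (continuous_iff_continuousAt.2 fun z => (analyticAt_of_hasSum hf z).continuousAt).comp
        Complex.continuous_ofReal
  obtain ⟨ξ, hanti, hξ⟩ := exists_strictAnti_zeros ha hp hq hc hcont hsum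
  refine ⟨ξ, Complex.ofReal_injective.comp hanti.injective, fun i => ⟨?_, ?_⟩⟩
  · refine (hf (ξ i)).unique ?_
    simpa only [(hξ i).1, Complex.ofReal_mul, Complex.ofReal_pow, Complex.ofReal_zero] using
      Complex.hasSum_ofReal.2 (hsum (ξ i))
  · rw [Complex.norm_real, Real.norm_eq_abs]
    exact (hξ i).2

end PositiveCoefficients

theorem theorem2_general (a : ℕ → ℝ) (f : ℂ → ℂ)
    (ha : ∀ k, 0 < a k)
    (hf : ∀ z : ℂ, HasSum (fun k : ℕ => (a k : ℂ) * z ^ k) (f z))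
    (hone : ∀ n : ℕ, 2 ≤ n → 1 ≤ secondQuotient a n)
    (j₀ m₀ : ℕ) (hj₀ : 2 ≤ j₀) (hm₀ : 1 ≤ m₀)
    (hmono : ∀ n : ℕ, j₀ ≤ n → secondQuotient a n ≤ secondQuotient a (n + 1))
    (hc : thetaConst (2 * m₀) ≤ secondQuotient a j₀) :
    (nonrealZeros f).Finite ∧
      (∑ᶠ z ∈ nonrealZeros f, analyticOrderAt f z) ≤ ((j₀ + 2 * m₀ - 2 : ℕ) : ℕ∞) := by
  obtain ⟨s, rfl⟩ := Nat.exists_eq_add_of_le' hj₀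
  obtain ⟨m, rfl⟩ := Nat.exists_eq_add_of_le' hm₀
  rw [show s + 2 + 2 * (m + 1) - 2 = s + 2 * m + 2 by lia]
  have hp : Monotone (coeffRatio a) := monotone_coeffRatio ha hone
  have hq : MonotoneOn (secondQuotient a) (Set.Ici (s + 2)) := monotoneOn_nat_Ici_of_le_succ hmono
  have hthree : 3 ≤ thetaConst (2 * (m + 1)) :=
    (three_le_thetaConst_and_exists_thetaWindow_eq_zero (by lia)).1
  have hdouble (k : ℕ) (hk : s ≤ k) : 2 * coeffRatio a k ≤ coeffRatio a (k + 1) :=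
    two_mul_coeffRatio_le ha (by linarith) hq hk
  have h0 : f 0 ≠ 0 := by
    rw [apply_zero_eq_of_hasSum hf]
    exact Complex.ofReal_ne_zero.2 (ha 0).ne'
  obtain ⟨ξ, hinj, hξ⟩ := exists_injective_ofReal_zeros ha hf hp hq hc
  exact finite_and_finsum_analyticOrderAt_le (analyticAt_of_hasSum hf) h0 (coeffRatio_pos ha) hp
    (le_max_left _ _) hinj hξ (tendsto_coeffRatio_atTop ha hdouble)
    (eventually_norm_le_mul_prod_coeffRatio ha hf hp hdouble) (fun w hw => hw.1)
    fun i hi => hi.2 (Complex.ofReal_im _)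

theorem theorem2 (a : ℕ → ℝ) (f : ℂ → ℂ)
    (ha : ∀ k, 0 < a k)
    (hf : ∀ z : ℂ, HasSum (fun k : ℕ => (a k : ℂ) * z ^ k) (f z))
    (hq2 : 2 * (2 : ℝ) ^ ((1 : ℝ) / 3) ≤ secondQuotient a 2)
    (hmono : ∀ n : ℕ, 2 ≤ n → secondQuotient a n ≤ secondQuotient a (n + 1))
    (j₀ m₀ : ℕ) (hj₀ : 2 ≤ j₀) (hm₀ : 1 ≤ m₀)
    (hc : thetaConst (2 * m₀) ≤ secondQuotient a j₀) :
    (nonrealZeros f).Finite ∧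
      (∑ᶠ z ∈ nonrealZeros f, analyticOrderAt f z) ≤ ((j₀ + 2 * m₀ - 2 : ℕ) : ℕ∞) := by
  have hroot : 1 ≤ (2 : ℝ) ^ ((1 : ℝ) / 3) := Real.one_le_rpow one_le_two (by norm_num)
  exact theorem2_general a f ha hf
    (fun n hn => (by linarith : 1 ≤ secondQuotient a 2).trans
      (monotoneOn_nat_Ici_of_le_succ hmono Set.self_mem_Ici hn hn))
    j₀ m₀ hj₀ hm₀ (fun n hn => hmono n (hj₀.trans hn)) hc
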